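/- Let $X$ be a topological space and let $K=\mathbb{Q}$ or $K=\mathbb{R}$ (more generally, $K$ may be any field of characteristic $0$). Let $C_n(X)$ be the group of singular $n$-chains, let $C^n(X)=\mathrm{Hom}(C_n(X),K)$ with coboundary $\delta\alpha=\alpha\circ\partial$, and let $H^n(X)$ be the singular cohomology. For a permutation $s$ of $\{0,\dots,n\}$ with sign $\epsilon(s)$ let $\bar s:\Delta^n\to\Delta^n$ be the map $\sum_j t_jv_j\mapsto\sum_j t_jv_{s(j)}$. A cochain $\alpha\in C^n(X)$ is called alternative if $\alpha(\sigma\circ\bar s)=\epsilon(s)\,\alpha(\sigma)$ for all $s$ and all singular simplices $\sigma:\Delta^n\to X$. The alternative cochains form a subcomplex $C^\bullet_A(X)$ of $C^\bullet(X)$; its cohomology is denoted $H^n_A(X)$. The alternative maker operator $A:C^n(X)\to C^n_A(X)$, $$A(\alpha)(\sigma)=\frac1{(n+1)!}\sum_{s}\epsilon(s)\,\alpha(\sigma\circ\bar s),$$ commutes with $\delta$ and so induces a $K$-linear map $A:H^n(X)\to H^n_A(X)$; let $j:H^n_A(X)\to H^n(X)$ be the map induced by the inclusion of cochains. Then for every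 $n\ge 0$: 1. $A\circ j=\mathrm{id}$ on $H^n_A(X)$ and $H^n(X)=j(H^n_A(X))\oplus\ker A$. In particular $j$ is injective and, identifying $H^n_A(X)$ with its image, $H^n(X)=H^n_A(X)\oplus\ker A$. 2. If $H^n(X)$ is a finitely generated $K$-module, then $A:H^n(X)\to H^n_A(X)$ is an isomorphism. 3. If $X$ is compact, then $A:H^n(X)\to H^n_A(X)$ is an isomorphism. -/

import Mathlib

open CategoryTheory

noncomputable section

namespace AltSingular

universe u

/-! ### Singular simplices, singular chains -/

/-- The standard `n`-simplex `Δⁿ`, with vertices indexed by `0, …, n`. -/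
abbrev Simplex (n : ℕ) : Type := stdSimplex ℝ (Fin (n + 1))

/-- The affine map `Δᵐ → Δⁿ` sending the vertex `v_j` to the vertex `v_{f j}`, that is
`∑ t_j v_j ↦ ∑ t_j v_{f j}`. -/
def simplexMap {m n : ℕ} (f : Fin (m + 1) → Fin (n + 1)) : C(Simplex m, Simplex n) :=
  ⟨stdSimplex.map f, stdSimplex.continuous_map f⟩

lemma simplexMap_comp {l m n : ℕ} (g : Fin (m + 1) → Fin (n + 1))
    (f : Fin (l + 1) → Fin (m + 1)) :
    (simplexMap g).comp (simplexMap f) = simplexMap (g ∘ f) := by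
  ext1 x
  exact stdSimplex.map_comp_apply f g x

/-- Singular `n`-simplices of `X`. -/
abbrev SingularSimplex (n : ℕ) (X : Type u) [TopologicalSpace X] : Type u :=
  C(Simplex n, X)

/-- The free abelian group `C_n(X)` on the singular `n`-simplices of `X`. -/
abbrev Chain (n : ℕ) (X : Type u) [TopologicalSpace X] : Type u :=
  SingularSimplex n X →₀ ℤ

variable {X : Type u} [TopologicalSpace X]

/-- The restriction of a singular simplex to its `i`-th face `[v_0, …, v̂_i, …, v_n]`. -/
def face {n : ℕ} (i : Fin (n + 2)) (σ : SingularSimplex (n + 1) X) : SingularSimplex n X :=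
  σ.comp (simplexMap i.succAbove)

/-- `σ ↦ σ ∘ s̄`, where `s̄ : Δⁿ → Δⁿ` is `∑ t_j v_j ↦ ∑ t_j v_{s j}`. -/
def permSimplex {n : ℕ} (s : Equiv.Perm (Fin (n + 1))) (σ : SingularSimplex n X) :
    SingularSimplex n X :=
  σ.comp (simplexMap s)

/-- The boundary operator `∂ : C_{n+1}(X) → C_n(X)`, `∂σ = ∑ (-1)^i σ|_{F_i}`. -/
def boundary (n : ℕ) (X : Type u) [TopologicalSpace X] : Chain (n + 1) X →ₗ[ℤ] Chain n X :=
  Finsupp.linearCombination ℤ fun σ =>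
    ∑ i : Fin (n + 2), (-1 : ℤ) ^ (i : ℕ) • Finsupp.single (face i σ) (1 : ℤ)

/-- The homomorphism `s̄^* : C_n(X) → C_n(X)` given on generators by `σ ↦ σ ∘ s̄`. -/
def permChain {n : ℕ} (s : Equiv.Perm (Fin (n + 1))) : Chain n X →ₗ[ℤ] Chain n X :=
  Finsupp.linearCombination ℤ fun σ => Finsupp.single (permSimplex s σ) (1 : ℤ)

/-! ### Cochains -/

/-- The singular cochains `C^n(X; K) = Hom(C_n(X), K)`. -/
abbrev Cochain (K : Type) [CommRing K] (n : ℕ) (X : Type u) [TopologicalSpace X] : Type u :=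
  Chain n X →ₗ[ℤ] K

section CommRing

variable {K : Type} [CommRing K]

lemma Cochain.ext {n : ℕ} {α β : Cochain K n X}
    (h : ∀ σ : SingularSimplex n X, α (Finsupp.single σ 1) = β (Finsupp.single σ 1)) : α = β :=
  Finsupp.lhom_ext' fun σ => LinearMap.ext_ring (h σ)

/-- The coboundary operator `δ α = α ∘ ∂`. -/
def coboundary (K : Type) [CommRing K] (n : ℕ) (X : Type u) [TopologicalSpace X] :
    Cochain K n X →ₗ[K] Cochain K (n + 1) X where
  toFun α := α ∘ₗ boundary n X
  map_add' _ _ := rfl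
  map_smul' _ _ := rfl

/-- The homomorphism `s̄^{**}` of `C^n(X; K)`, that is `α ↦ α ∘ s̄^*`. -/
def permCochain {n : ℕ} (s : Equiv.Perm (Fin (n + 1))) : Cochain K n X →ₗ[K] Cochain K n X where
  toFun α := α ∘ₗ permChain s
  map_add' _ _ := rfl
  map_smul' _ _ := rfl

lemma coboundary_single {n : ℕ} (α : Cochain K n X) (σ : SingularSimplex (n + 1) X) :
    coboundary K n X α (Finsupp.single σ 1) =
      ∑ i : Fin (n + 2), (-1 : K) ^ (i : ℕ) * α (Finsupp.single (face i σ) 1) := by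
  simp only [coboundary, boundary, LinearMap.coe_mk, AddHom.coe_mk, LinearMap.comp_apply,
    Finsupp.linearCombination_single, one_smul, map_sum, map_smul, zsmul_eq_mul]
  refine Finset.sum_congr rfl fun i _ => ?_
  push_cast
  rfl

lemma permCochain_single {n : ℕ} (s : Equiv.Perm (Fin (n + 1))) (α : Cochain K n X)
    (σ : SingularSimplex n X) :
    permCochain s α (Finsupp.single σ 1) = α (Finsupp.single (permSimplex s σ) 1) := by
  simp [permCochain, permChain]

lemma face_face {n : ℕ} (σ : SingularSimplex (n + 2) X) (i : Fin (n + 3)) (j : Fin (n + 2)) :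
    face (j.predAbove i) (face (i.succAbove j) σ) = face j (face i σ) := by
  simp only [face, ContinuousMap.comp_assoc, simplexMap_comp]
  congr 2
  funext k
  exact Fin.succAbove_succAbove_succAbove_predAbove i j k

lemma coboundary_coboundary {n : ℕ} (α : Cochain K n X) :
    coboundary K (n + 1) X (coboundary K n X α) = 0 := by
  refine Cochain.ext fun σ => ?_
  rw [coboundary_single, LinearMap.zero_apply]
  simp only [coboundary_single, Finset.mul_sum]
  rw [← Finset.sum_product' (s := Finset.univ) (t := Finset.univ)
    (f := fun (i : Fin (n + 3)) (j : Fin (n + 2)) =>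
      (-1 : K) ^ (i : ℕ) * ((-1 : K) ^ (j : ℕ) * α (Finsupp.single (face j (face i σ)) 1)))]
  refine Finset.sum_involution (fun p _ => (p.1.succAbove p.2, p.2.predAbove p.1)) ?_ ?_ ?_ ?_
  · rintro ⟨i, j⟩ _
    dsimp only
    rw [face_face, ← mul_assoc, ← mul_assoc, ← pow_add, ← pow_add,
      Fin.neg_one_pow_succAbove_add_predAbove]
    ring
  · rintro ⟨i, j⟩ _ _ h
    exact Fin.succAbove_ne i j (congrArg Prod.fst h)
  · intros
    simp
  · rintro ⟨i, j⟩ _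
    ext : 1
    · simp [Fin.succAbove_succAbove_predAbove]
    · simp [Fin.predAbove_predAbove_succAbove]

/-- The submodule `C^n_A(X; K)` of alternative cochains: those with `s̄^{**} α = ε(s) α` for every
permutation `s` of the vertices. -/
def altCochain (K : Type) [CommRing K] (n : ℕ) (X : Type u) [TopologicalSpace X] :
    Submodule K (Cochain K n X) where
  carrier := {α | ∀ s : Equiv.Perm (Fin (n + 1)),
    permCochain s α = (Equiv.Perm.sign s : ℤ) • α}
  zero_mem' s := by simp
  add_mem' ha hb s := by rw [map_add, ha s, hb s, smul_add]
  smul_mem' c α ha s := by rw [map_smul, ha s, smul_comm]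

/-! ### Faces of permuted simplices -/

/-- The permutation taking `i` to `j` and inducing `e` on the remaining elements, renumbered. -/
def insertPerm {n : ℕ} (i j : Fin (n + 1)) (e : Equiv.Perm (Fin n)) :
    Equiv.Perm (Fin (n + 1)) :=
  j.cycleRange⁻¹ * Equiv.Perm.decomposeFin.symm (0, e) * i.cycleRange

lemma insertPerm_self {n : ℕ} (i j : Fin (n + 1)) (e : Equiv.Perm (Fin n)) :
    insertPerm i j e i = j := by
  simp [insertPerm, Equiv.Perm.mul_apply, Equiv.Perm.inv_def]

lemma insertPerm_succAbove {n : ℕ} (i j : Fin (n + 1)) (e : Equiv.Perm (Fin n)) (k : Fin n) :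
    insertPerm i j e (i.succAbove k) = j.succAbove (e k) := by
  simp [insertPerm, Equiv.Perm.mul_apply, Equiv.Perm.inv_def]

lemma sign_insertPerm {n : ℕ} (i j : Fin (n + 1)) (e : Equiv.Perm (Fin n)) :
    (Equiv.Perm.sign (insertPerm i j e) : ℤ) =
      (-1) ^ (i : ℕ) * (-1) ^ (j : ℕ) * Equiv.Perm.sign e := by
  simp only [insertPerm, Equiv.Perm.sign_mul, Equiv.Perm.sign_inv, Fin.sign_cycleRange,
    Equiv.Perm.decomposeFin.symm_sign, if_pos]
  push_cast
  ring

lemma insertPerm_bijective {n : ℕ} (i : Fin (n + 1)) :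
    Function.Bijective fun p : Fin (n + 1) × Equiv.Perm (Fin n) => insertPerm i p.1 p.2 := by
  rw [Fintype.bijective_iff_injective_and_card]
  constructor
  · rintro ⟨j, e⟩ ⟨j', e'⟩ h
    dsimp only at h
    have hj : j = j' := by
      rw [← insertPerm_self i j e, h, insertPerm_self]
    subst hj
    congr 1
    ext k : 1
    apply Fin.succAbove_right_injective (p := j)
    rw [← insertPerm_succAbove i, h, insertPerm_succAbove]
  · simp [Fintype.card_perm, Nat.factorial_succ]

lemma face_permSimplex {n : ℕ} (i j : Fin (n + 2)) (e : Equiv.Perm (Fin (n + 1)))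
    (σ : SingularSimplex (n + 1) X) :
    face i (permSimplex (insertPerm i j e) σ) = permSimplex e (face j σ) := by
  simp only [face, permSimplex, ContinuousMap.comp_assoc, simplexMap_comp]
  congr 2
  funext k
  exact insertPerm_succAbove i j e k

/-- `δ` takes alternative cochains to alternative cochains. -/
lemma coboundary_mem_altCochain {n : ℕ} {α : Cochain K n X} (hα : α ∈ altCochain K n X) :
    coboundary K n X α ∈ altCochain K (n + 1) X := by
  intro s
  refine Cochain.ext fun σ => ?_
  rw [permCochain_single, coboundary_single, LinearMap.smul_apply, coboundary_single,
    Finset.smul_sum]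
  conv_rhs => rw [← Equiv.sum_comp s]
  refine Finset.sum_congr rfl fun i _ => ?_
  obtain ⟨⟨j, e⟩, rfl⟩ := (insertPerm_bijective i).2 s
  dsimp only
  rw [face_permSimplex, insertPerm_self, ← permCochain_single, hα e, sign_insertPerm,
    LinearMap.smul_apply, zsmul_eq_mul, zsmul_eq_mul]
  push_cast
  have h : (-1 : K) ^ (j : ℕ) * (-1 : K) ^ (j : ℕ) = 1 := by
    rw [← mul_pow]; simp
  linear_combination (-(-1 : K) ^ (i : ℕ) * ((Equiv.Perm.sign e : ℤ) : K) *
    α (Finsupp.single (face j σ) 1)) * h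

/-- The coboundary operator on alternative cochains. -/
def altCoboundary (K : Type) [CommRing K] (n : ℕ) (X : Type u) [TopologicalSpace X] :
    altCochain K n X →ₗ[K] altCochain K (n + 1) X :=
  (coboundary K n X).restrict fun _ h => coboundary_mem_altCochain h

/-! ### Singular and alternative cohomology -/

/-- The singular cochain complex of `X` with coefficients in `K`. -/
def singularCochainComplex (K : Type) [CommRing K] (X : Type u) [TopologicalSpace X] :
    CochainComplex (ModuleCat.{u} K) ℕ :=
  CochainComplex.of (fun n => ModuleCat.of K (Cochain K n X))
    (fun n => ModuleCat.ofHom (coboundary K n X))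
    (fun n => by
      ext1
      exact LinearMap.ext fun α => coboundary_coboundary α)

/-- The subcomplex of alternative singular cochains. -/
def altCochainComplex (K : Type) [CommRing K] (X : Type u) [TopologicalSpace X] :
    CochainComplex (ModuleCat.{u} K) ℕ :=
  CochainComplex.of (fun n => ModuleCat.of K (altCochain K n X))
    (fun n => ModuleCat.ofHom (altCoboundary K n X))
    (fun n => by
      ext1
      exact LinearMap.ext fun α => Subtype.ext (coboundary_coboundary α.1))

/-- The singular cohomology `H^n(X; K)`. -/
abbrev singularCohomology (K : Type) [CommRing K] (n : ℕ) (X : Type u) [TopologicalSpace X] :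
    ModuleCat.{u} K :=
  (singularCochainComplex K X).homology n

/-- The alternative cohomology `H^n_A(X; K)`. -/
abbrev altCohomology (K : Type) [CommRing K] (n : ℕ) (X : Type u) [TopologicalSpace X] :
    ModuleCat.{u} K :=
  (altCochainComplex K X).homology n

/-- The inclusion of the alternative cochains, as a cochain map. -/
def inclusion (K : Type) [CommRing K] (X : Type u) [TopologicalSpace X] :
    altCochainComplex K X ⟶ singularCochainComplex K X :=
  CochainComplex.ofHom (fun n => ModuleCat.ofHom (altCochain K n X).subtype)
    (fun n => by
      simp only [altCochainComplex, singularCochainComplex, CochainComplex.of_d]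
      rfl)

/-- The map `j : H^n_A(X; K) → H^n(X; K)` induced by the inclusion of cochains. -/
def inclusionCohomology (K : Type) [CommRing K] (n : ℕ) (X : Type u) [TopologicalSpace X] :
    altCohomology K n X →ₗ[K] singularCohomology K n X :=
  (HomologicalComplex.homologyMap (inclusion K X) n).hom

end CommRing

/-! ### The alternative maker operator -/

section Field

variable {K : Type} [Field K]

/-- `α ↦ 1 / (n+1)! ∑_s ε(s) s̄^{**} α`, as an endomorphism of `C^n(X; K)`. -/
def altMakerAux (K : Type) [Field K] (n : ℕ) (X : Type u) [TopologicalSpace X] :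
    Cochain K n X →ₗ[K] Cochain K n X :=
  (1 / ((n + 1).factorial : K)) •
    ∑ s : Equiv.Perm (Fin (n + 1)), (Equiv.Perm.sign s : ℤ) • permCochain s

lemma altMakerAux_single {n : ℕ} (α : Cochain K n X) (σ : SingularSimplex n X) :
    altMakerAux K n X α (Finsupp.single σ 1) = (1 / ((n + 1).factorial : K)) *
      ∑ s : Equiv.Perm (Fin (n + 1)),
        ((Equiv.Perm.sign s : ℤ) : K) * α (Finsupp.single (permSimplex s σ) 1) := by
  simp [altMakerAux, LinearMap.sum_apply, permCochain_single]

lemma permSimplex_permSimplex {n : ℕ} (s t : Equiv.Perm (Fin (n + 1)))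
    (σ : SingularSimplex n X) : permSimplex s (permSimplex t σ) = permSimplex (t * s) σ := by
  simp only [permSimplex, ContinuousMap.comp_assoc, simplexMap_comp, Equiv.Perm.coe_mul]

lemma altMakerAux_mem {n : ℕ} (α : Cochain K n X) : altMakerAux K n X α ∈ altCochain K n X := by
  intro t
  refine Cochain.ext fun σ => ?_
  rw [permCochain_single, LinearMap.smul_apply, altMakerAux_single, altMakerAux_single,
    zsmul_eq_mul, mul_left_comm]
  congr 1
  conv_rhs => rw [← Equiv.sum_comp (Equiv.mulLeft t), Finset.mul_sum]
  refine Finset.sum_congr rfl fun s _ => ?_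
  have h : ((Equiv.Perm.sign t : ℤ) : K) * ((Equiv.Perm.sign t : ℤ) : K) = 1 := by
    rw [← Int.cast_mul, ← Units.val_mul, Int.units_mul_self]; simp
  rw [permSimplex_permSimplex, Equiv.coe_mulLeft, Equiv.Perm.sign_mul]
  push_cast
  linear_combination (-((Equiv.Perm.sign s : ℤ) : K) *
    α (Finsupp.single (permSimplex (t * s) σ) 1)) * h

/-- The alternative maker operator `A : C^n(X; K) → C^n_A(X; K)`. -/
def altMaker (K : Type) [Field K] (n : ℕ) (X : Type u) [TopologicalSpace X] :
    Cochain K n X →ₗ[K] altCochain K n X :=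
  (altMakerAux K n X).codRestrict _ altMakerAux_mem

variable [CharZero K]

/-- `A δ = δ A`. -/
lemma altMakerAux_coboundary {n : ℕ} (α : Cochain K n X) :
    altMakerAux K (n + 1) X (coboundary K n X α) = coboundary K n X (altMakerAux K n X α) := by
  refine Cochain.ext fun σ => ?_
  rw [altMakerAux_single, coboundary_single]
  simp only [coboundary_single, altMakerAux_single]
  have key : ∀ i : Fin (n + 2),
      ∑ s : Equiv.Perm (Fin (n + 2)), ((Equiv.Perm.sign s : ℤ) : K) *
        ((-1 : K) ^ (i : ℕ) * α (Finsupp.single (face i (permSimplex s σ)) 1)) =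
      ∑ j : Fin (n + 2), (-1 : K) ^ (j : ℕ) * ∑ e : Equiv.Perm (Fin (n + 1)),
        ((Equiv.Perm.sign e : ℤ) : K) * α (Finsupp.single (permSimplex e (face j σ)) 1) := by
    intro i
    rw [← (insertPerm_bijective i).sum_comp, Fintype.sum_prod_type]
    refine Finset.sum_congr rfl fun j _ => ?_
    rw [Finset.mul_sum]
    refine Finset.sum_congr rfl fun e _ => ?_
    dsimp only
    rw [face_permSimplex, sign_insertPerm]
    have h : (-1 : K) ^ (i : ℕ) * (-1 : K) ^ (i : ℕ) = 1 := by
      rw [← mul_pow]; simp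
    push_cast
    linear_combination ((-1 : K) ^ (j : ℕ) * ((Equiv.Perm.sign e : ℤ) : K) *
      α (Finsupp.single (permSimplex e (face j σ)) 1)) * h
  simp only [Finset.mul_sum] at key ⊢
  rw [Finset.sum_comm]
  simp only [← Finset.mul_sum] at key ⊢
  rw [Finset.sum_congr rfl fun i _ => key i, Finset.sum_const, Finset.card_univ, Fintype.card_fin,
    nsmul_eq_mul, ← mul_assoc, Finset.mul_sum]
  refine Finset.sum_congr rfl fun j _ => ?_
  rw [Nat.factorial_succ (n + 1)]
  have h1 : ((n + 1).factorial : K) ≠ 0 := Nat.cast_ne_zero.2 (Nat.factorial_ne_zero _)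
  have h2 : ((n : K) + 1 + 1) ≠ 0 := by exact_mod_cast Nat.succ_ne_zero (n + 1)
  push_cast
  field_simp
  ring

/-- The alternative maker operator, as a cochain map. -/
def altMakerHom (K : Type) [Field K] [CharZero K] (X : Type u) [TopologicalSpace X] :
    singularCochainComplex K X ⟶ altCochainComplex K X :=
  CochainComplex.ofHom (fun n => ModuleCat.ofHom (altMaker K n X))
    (fun n => by
      simp only [altCochainComplex, singularCochainComplex, CochainComplex.of_d]
      ext1
      exact LinearMap.ext fun α => Subtype.ext (altMakerAux_coboundary α).symm)

/-- The map `A : H^n(X; K) → H^n_A(X; K)` induced by the alternative maker operator. -/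
def altMakerCohomology (K : Type) [Field K] [CharZero K] (n : ℕ) (X : Type u)
    [TopologicalSpace X] : singularCohomology K n X →ₗ[K] altCohomology K n X :=
  (HomologicalComplex.homologyMap (altMakerHom K X) n).hom

end Field

end AltSingular

end

/-!
The operator `A`, followed by the inclusion of the alternative cochains, is cochain homotopic to the
identity, so over a field of characteristic zero `A` and `j` are mutually inverse on cohomology for
every space `X`: `ker A` vanishes and `j` is onto.

The homotopy comes from the method of acyclic models. The value of `A α` at a singular simplex
`σ : Δᴺ → X` only involves simplices `σ ∘ f` with `f` the affine extension of a map of vertices, so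
that everything happens in the cochain complexes of functions on words `Fin (n + 1) → V`, with
`V = Fin (N + 1)`. Prepending a letter `v` to each word is a contraction of such a complex
(`prepend_ordCoboundary`): `δ β (v, f) = β f - δ (β (v, ·)) f`. In a homotopy `H` with
`H δ + δ H = 1 - A`, this suggests the recursion `H β f = (1 - A - δ H) (β (f 0, ·)) f`, taken here
as the definition of `H` (`ordHomotopy`). The homotopy identity follows by induction from
`A δ = δ A` and from `A = 1` in degree zero (`ordHomotopy_coboundary`); naturality of `H` in `V`
(`ordHomotopy_natural`) carries it over to singular cochains
(`singularHomotopy_coboundary`).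
-/

open CategoryTheory

noncomputable section

namespace AltSingular

universe u

/-! ### Cochains on words -/

section Ordered

variable {K : Type} [Field K] {V W : Type} {n : ℕ}

/-- The ordered `n`-cochains of a set `V`: all functions on words of length `n + 1` in `V`, with
repeated letters allowed. -/
abbrev OrdCochain (K : Type) (n : ℕ) (V : Type) : Type := (Fin (n + 1) → V) → K

/-- The coboundary of ordered cochains. -/
def ordCoboundary (K : Type) [Field K] (n : ℕ) (V : Type) :
    OrdCochain K n V →ₗ[K] OrdCochain K (n + 1) V :=
  LinearMap.pi fun f => ∑ i : Fin (n + 2), (-1 : K) ^ (i : ℕ) • LinearMap.proj (f ∘ i.succAbove)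

/-- The alternative maker operator on ordered cochains. -/
def ordAlt (K : Type) [Field K] (n : ℕ) (V : Type) : OrdCochain K n V →ₗ[K] OrdCochain K n V :=
  LinearMap.pi fun f => (1 / ((n + 1).factorial : K)) •
    ∑ s : Equiv.Perm (Fin (n + 1)), ((Equiv.Perm.sign s : ℤ) : K) • LinearMap.proj (f ∘ s)

/-- The contraction `β ↦ β (v, ·)`, evaluation on words starting with the letter `v`. -/
def prepend (K : Type) [Field K] (n : ℕ) (v : V) : OrdCochain K (n + 1) V →ₗ[K] OrdCochain K n V :=
  LinearMap.funLeft K K fun f => (Fin.cons v f : Fin (n + 2) → V)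

lemma ordCoboundary_apply (β : OrdCochain K n V) (f : Fin (n + 2) → V) :
    ordCoboundary K n V β f = ∑ i : Fin (n + 2), (-1 : K) ^ (i : ℕ) * β (f ∘ i.succAbove) := by
  simp [ordCoboundary]

lemma ordAlt_apply (β : OrdCochain K n V) (f : Fin (n + 1) → V) :
    ordAlt K n V β f = (1 / ((n + 1).factorial : K)) *
      ∑ s : Equiv.Perm (Fin (n + 1)), ((Equiv.Perm.sign s : ℤ) : K) * β (f ∘ s) := by
  simp [ordAlt]

lemma prepend_apply (v : V) (β : OrdCochain K (n + 1) V) (f : Fin (n + 1) → V) :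
    prepend K n v β f = β (Fin.cons v f : Fin (n + 2) → V) := rfl

lemma ordCoboundary_ordCoboundary (β : OrdCochain K n V) :
    ordCoboundary K (n + 1) V (ordCoboundary K n V β) = 0 := by
  funext f
  simp only [ordCoboundary_apply, Finset.mul_sum, Pi.zero_apply]
  rw [← Finset.sum_product' (s := Finset.univ) (t := Finset.univ)
    (f := fun (i : Fin (n + 3)) (j : Fin (n + 2)) =>
      (-1 : K) ^ (i : ℕ) * ((-1 : K) ^ (j : ℕ) * β ((f ∘ i.succAbove) ∘ j.succAbove)))]
  -- The pairs `(i, j)` which delete the same two letters in opposite orders cancel.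
  refine Finset.sum_involution (fun p _ => (p.1.succAbove p.2, p.2.predAbove p.1)) ?_ ?_ ?_ ?_
  · rintro ⟨i, j⟩ _
    have h : (f ∘ (i.succAbove j).succAbove) ∘ (j.predAbove i).succAbove =
        (f ∘ i.succAbove) ∘ j.succAbove := by
      funext k
      exact congrArg f (Fin.succAbove_succAbove_succAbove_predAbove i j k)
    dsimp only
    rw [h, ← mul_assoc, ← mul_assoc, ← pow_add, ← pow_add,
      Fin.neg_one_pow_succAbove_add_predAbove]
    ring
  · rintro ⟨i, j⟩ _ _ h
    exact Fin.succAbove_ne i j (congrArg Prod.fst h)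
  · intros
    simp
  · rintro ⟨i, j⟩ _
    ext : 1
    · simp [Fin.succAbove_succAbove_predAbove]
    · simp [Fin.predAbove_predAbove_succAbove]

/-- Prepending a letter contracts the complex of ordered cochains. -/
lemma prepend_ordCoboundary (v : V) (β : OrdCochain K (n + 1) V) :
    prepend K (n + 1) v (ordCoboundary K (n + 1) V β) =
      β - ordCoboundary K n V (prepend K n v β) := by
  funext f
  have h0 : (Fin.cons v f : Fin (n + 3) → V) ∘ (0 : Fin (n + 3)).succAbove = f := by
    funext k
    simp
  have hs (i : Fin (n + 2)) : (Fin.cons v f : Fin (n + 3) → V) ∘ i.succ.succAbove =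
      (Fin.cons v (f ∘ i.succAbove) : Fin (n + 2) → V) := by
    funext k
    cases k using Fin.cases <;> simp
  rw [prepend_apply, ordCoboundary_apply, Fin.sum_univ_succ, h0, Pi.sub_apply,
    ordCoboundary_apply, sub_eq_add_neg, ← Finset.sum_neg_distrib]
  congr 1
  · simp
  · refine Finset.sum_congr rfl fun i _ => ?_
    rw [hs, prepend_apply, Fin.val_succ]
    ring

lemma ordAlt_zero (β : OrdCochain K 0 V) : ordAlt K 0 V β = β := by
  funext f
  have hs : (Finset.univ : Finset (Equiv.Perm (Fin (0 + 1)))) = {1} := by decide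
  rw [ordAlt_apply, hs, Finset.sum_singleton]
  simp

lemma ordAlt_ordCoboundary [CharZero K] (β : OrdCochain K n V) :
    ordAlt K (n + 1) V (ordCoboundary K n V β) = ordCoboundary K n V (ordAlt K n V β) := by
  funext f
  -- For a fixed `i`, a permutation of the letters amounts to the letter `j` sent to place `i` and a
  -- permutation `e` of the others; the sum over `e` is the same for each of the `n + 2` values
  -- of `i`, which accounts for the ratio of the factorials.
  have key (i : Fin (n + 2)) :
      ∑ s : Equiv.Perm (Fin (n + 2)), ((Equiv.Perm.sign s : ℤ) : K) *
        ((-1 : K) ^ (i : ℕ) * β ((f ∘ s) ∘ i.succAbove)) =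
      ∑ j : Fin (n + 2), (-1 : K) ^ (j : ℕ) * ∑ e : Equiv.Perm (Fin (n + 1)),
        ((Equiv.Perm.sign e : ℤ) : K) * β ((f ∘ j.succAbove) ∘ e) := by
    rw [← (insertPerm_bijective i).sum_comp, Fintype.sum_prod_type]
    refine Finset.sum_congr rfl fun j _ => ?_
    rw [Finset.mul_sum]
    refine Finset.sum_congr rfl fun e _ => ?_
    have hf : (f ∘ insertPerm i j e) ∘ i.succAbove = (f ∘ j.succAbove) ∘ e := by
      funext k
      exact congrArg f (insertPerm_succAbove i j e k)
    dsimp only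
    rw [hf, sign_insertPerm]
    have h : (-1 : K) ^ (i : ℕ) * (-1 : K) ^ (i : ℕ) = 1 := by
      rw [← mul_pow]; simp
    push_cast
    linear_combination ((-1 : K) ^ (j : ℕ) * ((Equiv.Perm.sign e : ℤ) : K) *
      β ((f ∘ j.succAbove) ∘ e)) * h
  have hsum : ∑ s : Equiv.Perm (Fin (n + 2)), ((Equiv.Perm.sign s : ℤ) : K) *
      ordCoboundary K n V β (f ∘ s) = ((n : K) + 2) *
        ∑ j : Fin (n + 2), (-1 : K) ^ (j : ℕ) * ∑ e : Equiv.Perm (Fin (n + 1)),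
          ((Equiv.Perm.sign e : ℤ) : K) * β ((f ∘ j.succAbove) ∘ e) := by
    simp only [ordCoboundary_apply, Finset.mul_sum (s := Finset.univ (α := Fin (n + 2)))]
    rw [Finset.sum_comm, Finset.sum_congr rfl fun i _ => key i, Finset.sum_const,
      Finset.card_univ, Fintype.card_fin, nsmul_eq_mul, ← Finset.mul_sum]
    push_cast
    ring
  have h1 : ((n + 1).factorial : K) ≠ 0 := Nat.cast_ne_zero.2 (Nat.factorial_ne_zero _)
  have h2 : ((n : K) + 2) ≠ 0 := by exact_mod_cast Nat.succ_ne_zero (n + 1)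
  have hc : 1 / ((n + 1 + 1).factorial : K) * ((n : K) + 2) = 1 / ((n + 1).factorial : K) := by
    have h3 : ((n + 1 + 1).factorial : K) = ((n : K) + 2) * ((n + 1).factorial : K) := by
      rw [Nat.factorial_succ (n + 1)]
      push_cast
      ring
    rw [h3]
    field_simp
  rw [ordAlt_apply, hsum, ← mul_assoc, hc, ordCoboundary_apply, Finset.mul_sum]
  refine Finset.sum_congr rfl fun j _ => ?_
  rw [ordAlt_apply]
  ring

/-! ### The homotopy on words -/

/-- The homotopy between `A` and the identity on ordered cochains: `H β f` is the value at `f` of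
`(1 - A - δ H) (β (f 0, ·))`. It vanishes in the lowest degree, where `A` is the identity. -/
def ordHomotopy (K : Type) [Field K] (V : Type) :
    (n : ℕ) → OrdCochain K (n + 1) V →ₗ[K] OrdCochain K n V
  | 0 => 0
  | n + 1 => LinearMap.pi fun f => LinearMap.proj f ∘ₗ
      (LinearMap.id - ordAlt K (n + 1) V - ordCoboundary K n V ∘ₗ ordHomotopy K V n) ∘ₗ
        prepend K (n + 1) (f 0)

lemma ordHomotopy_zero (β : OrdCochain K 1 V) : ordHomotopy K V 0 β = 0 := rfl

lemma ordHomotopy_succ (β : OrdCochain K (n + 2) V) (f : Fin (n + 2) → V) :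
    ordHomotopy K V (n + 1) β f = (prepend K (n + 1) (f 0) β -
      ordAlt K (n + 1) V (prepend K (n + 1) (f 0) β) -
        ordCoboundary K n V (ordHomotopy K V n (prepend K (n + 1) (f 0) β))) f := rfl

/-- The homotopy identity in degree `n + 1`, granted that `1 - A - δ H` kills coboundaries there. -/
lemma ordHomotopy_coboundary_of_kills
    (h : ∀ γ : OrdCochain K n V, ordCoboundary K n V γ -
      ordAlt K (n + 1) V (ordCoboundary K n V γ) -
        ordCoboundary K n V (ordHomotopy K V n (ordCoboundary K n V γ)) = 0)
    (β : OrdCochain K (n + 1) V) :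
    ordHomotopy K V (n + 1) (ordCoboundary K (n + 1) V β) =
      β - ordAlt K (n + 1) V β - ordCoboundary K n V (ordHomotopy K V n β) := by
  funext f
  rw [ordHomotopy_succ, prepend_ordCoboundary, ← sub_eq_zero, ← Pi.sub_apply,
    ← Pi.zero_apply (M := fun _ => K) f]
  refine congrFun ?_ f
  rw [← neg_eq_zero, ← h (prepend K n (f 0) β)]
  simp only [map_sub]
  abel

lemma ordHomotopy_kills [CharZero K] (γ : OrdCochain K n V) :
    ordCoboundary K n V γ - ordAlt K (n + 1) V (ordCoboundary K n V γ) -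
      ordCoboundary K n V (ordHomotopy K V n (ordCoboundary K n V γ)) = 0 := by
  induction n with
  | zero => rw [ordAlt_ordCoboundary, ordAlt_zero, ordHomotopy_zero, map_zero, sub_self, sub_zero]
  | succ n ih =>
    rw [ordHomotopy_coboundary_of_kills ih, ordAlt_ordCoboundary, map_sub, map_sub,
      ordCoboundary_ordCoboundary, sub_zero, sub_self]

lemma ordHomotopy_coboundary [CharZero K] (β : OrdCochain K (n + 1) V) :
    ordHomotopy K V (n + 1) (ordCoboundary K (n + 1) V β) =
      β - ordAlt K (n + 1) V β - ordCoboundary K n V (ordHomotopy K V n β) :=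
  ordHomotopy_coboundary_of_kills ordHomotopy_kills β

/-- The homotopy is natural with respect to maps of alphabets. -/
lemma ordHomotopy_natural (u : V → W) (β : OrdCochain K (n + 1) W) (f : Fin (n + 1) → V) :
    ordHomotopy K V n (fun g => β (u ∘ g)) f = ordHomotopy K W n β (u ∘ f) := by
  induction n with
  | zero => rfl
  | succ n ih =>
    have hp : prepend K (n + 1) (f 0) (fun g => β (u ∘ g)) =
        fun g => prepend K (n + 1) ((u ∘ f) 0) β (u ∘ g) := by
      funext g
      rw [prepend_apply, prepend_apply, Fin.comp_cons, Function.comp_apply]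
    simp only [ordHomotopy_succ, hp, Pi.sub_apply, ordAlt_apply, ordCoboundary_apply, ih,
      Function.comp_assoc]

end Ordered

/-! ### The homotopy on singular cochains -/

section Singular

variable {K : Type} [Field K] {X : Type u} [TopologicalSpace X] {n N : ℕ}

/-- The pullback of a singular cochain along a singular simplex `σ : Δᴺ → X`, as an ordered cochain
on the vertices of `Δᴺ`: a word `f` stands for the affine simplex with vertices `v_{f j}`. -/
def ordPullback (K : Type) [Field K] (n : ℕ) (σ : SingularSimplex N X) :
    Cochain K n X →ₗ[K] OrdCochain K n (Fin (N + 1)) where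
  toFun α f := α (Finsupp.single (σ.comp (simplexMap f)) 1)
  map_add' _ _ := rfl
  map_smul' _ _ := rfl

lemma ordPullback_apply (σ : SingularSimplex N X) (α : Cochain K n X)
    (f : Fin (n + 1) → Fin (N + 1)) :
    ordPullback K n σ α f = α (Finsupp.single (σ.comp (simplexMap f)) 1) := rfl

lemma ordPullback_id (σ : SingularSimplex n X) (α : Cochain K n X) :
    ordPullback K n σ α id = α (Finsupp.single σ 1) := by
  rw [ordPullback_apply]
  congr 2
  ext1 x
  exact congrArg σ (stdSimplex.map_id_apply x)

lemma ordPullback_comp {M : ℕ} (σ : SingularSimplex N X) (u : Fin (M + 1) → Fin (N + 1))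
    (α : Cochain K n X) :
    ordPullback K n (σ.comp (simplexMap u)) α = fun g => ordPullback K n σ α (u ∘ g) := by
  funext g
  rw [ordPullback_apply, ordPullback_apply, ContinuousMap.comp_assoc, simplexMap_comp]

lemma ordPullback_coboundary (σ : SingularSimplex N X) (α : Cochain K n X) :
    ordPullback K (n + 1) σ (coboundary K n X α) =
      ordCoboundary K n (Fin (N + 1)) (ordPullback K n σ α) := by
  funext f
  simp only [ordPullback_apply, coboundary_single, ordCoboundary_apply, face,
    ContinuousMap.comp_assoc, simplexMap_comp]

lemma ordPullback_altMakerAux (σ : SingularSimplex N X) (α : Cochain K n X) :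
    ordPullback K n σ (altMakerAux K n X α) =
      ordAlt K n (Fin (N + 1)) (ordPullback K n σ α) := by
  funext f
  simp only [ordPullback_apply, altMakerAux_single, ordAlt_apply, permSimplex,
    ContinuousMap.comp_assoc, simplexMap_comp]

/-- The homotopy on singular cochains, whose value at `σ : Δⁿ → X` is that of the homotopy on words
at the word `0, 1, …, n` of all the vertices of `Δⁿ`. -/
def singularHomotopy (K : Type) [Field K] (n : ℕ) (X : Type u) [TopologicalSpace X] :
    Cochain K (n + 1) X →ₗ[K] Cochain K n X where
  toFun α := Finsupp.linearCombination ℤ fun σ =>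
    ordHomotopy K (Fin (n + 1)) n (ordPullback K (n + 1) σ α) id
  map_add' α β := Cochain.ext fun σ => by simp
  map_smul' c α := Cochain.ext fun σ => by simp

lemma singularHomotopy_single (α : Cochain K (n + 1) X) (σ : SingularSimplex n X) :
    singularHomotopy K n X α (Finsupp.single σ 1) =
      ordHomotopy K (Fin (n + 1)) n (ordPullback K (n + 1) σ α) id := by
  simp [singularHomotopy]

lemma ordPullback_singularHomotopy (σ : SingularSimplex N X) (α : Cochain K (n + 1) X) :
    ordPullback K n σ (singularHomotopy K n X α) =
      ordHomotopy K (Fin (N + 1)) n (ordPullback K (n + 1) σ α) := by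
  funext f
  rw [ordPullback_apply, singularHomotopy_single, ordPullback_comp, ordHomotopy_natural,
    Function.comp_id]

lemma altMakerAux_zero (α : Cochain K 0 X) : altMakerAux K 0 X α = α :=
  Cochain.ext fun σ => by
    rw [← ordPullback_id, ordPullback_altMakerAux, ordAlt_zero, ordPullback_id]

lemma singularHomotopy_coboundary_zero (α : Cochain K 0 X) :
    singularHomotopy K 0 X (coboundary K 0 X α) = 0 :=
  Cochain.ext fun σ => by
    rw [singularHomotopy_single, ordHomotopy_zero]
    rfl

lemma singularHomotopy_coboundary [CharZero K] (α : Cochain K (n + 1) X) :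
    singularHomotopy K (n + 1) X (coboundary K (n + 1) X α) =
      α - altMakerAux K (n + 1) X α - coboundary K n X (singularHomotopy K n X α) :=
  Cochain.ext fun σ => by
    rw [singularHomotopy_single, ordPullback_coboundary, ordHomotopy_coboundary,
      ← ordPullback_altMakerAux, ← ordPullback_singularHomotopy, ← ordPullback_coboundary,
      ← map_sub, ← map_sub, ordPullback_id]

/-! ### Passage to cohomology -/

lemma altMakerAux_of_mem [CharZero K] {α : Cochain K n X} (hα : α ∈ altCochain K n X) :
    altMakerAux K n X α = α := by
  refine Cochain.ext fun σ => ?_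
  have h (s : Equiv.Perm (Fin (n + 1))) : ((Equiv.Perm.sign s : ℤ) : K) *
      α (Finsupp.single (permSimplex s σ) 1) = α (Finsupp.single σ 1) := by
    rw [← permCochain_single, hα s, LinearMap.smul_apply, zsmul_eq_mul, ← mul_assoc,
      ← Int.cast_mul, ← Units.val_mul, Int.units_mul_self]
    simp
  have h1 : ((n + 1).factorial : K) ≠ 0 := Nat.cast_ne_zero.2 (Nat.factorial_ne_zero _)
  rw [altMakerAux_single, Finset.sum_congr rfl fun s _ => h s, Finset.sum_const, Finset.card_univ,
    Fintype.card_perm, Fintype.card_fin, nsmul_eq_mul]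
  field_simp

variable (K X) in
lemma inclusion_comp_altMakerHom [CharZero K] :
    inclusion K X ≫ altMakerHom K X = 𝟙 (altCochainComplex K X) := by
  have h (n : ℕ) : altMaker K n X ∘ₗ (altCochain K n X).subtype = LinearMap.id :=
    LinearMap.ext fun α => Subtype.ext (altMakerAux_of_mem α.2)
  ext n : 1
  exact congrArg ModuleCat.ofHom (h n)

variable (K X) in
/-- The components of the cochain homotopy between `j ∘ A` and the identity. -/
def homotopyComponent (i k : ℕ) (h : (ComplexShape.up ℕ).Rel k i) :
    (singularCochainComplex K X).X i ⟶ (singularCochainComplex K X).X k :=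
  match i, h with
  | _, rfl => ModuleCat.ofHom (singularHomotopy K k X)

variable (K X) in
lemma altMakerHom_comp_inclusion [CharZero K] :
    𝟙 (singularCochainComplex K X) - altMakerHom K X ≫ inclusion K X =
      Homotopy.nullHomotopicMap' (homotopyComponent K X) := by
  ext n : 1
  have hd (m : ℕ) : (singularCochainComplex K X).d m (m + 1) =
      ModuleCat.ofHom (coboundary K m X) := by
    simp only [singularCochainComplex, CochainComplex.of_d]
  cases n with
  | zero =>
    rw [Homotopy.nullHomotopicMap'_f_of_not_rel_right (k₁ := 0) (k₀ := 1) rfl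
      (fun l h => Nat.succ_ne_zero l h), hd]
    ext1
    refine LinearMap.ext fun α => ?_
    exact (sub_eq_zero.2 (altMakerAux_zero α).symm).trans
      (singularHomotopy_coboundary_zero α).symm
  | succ n =>
    rw [Homotopy.nullHomotopicMap'_f (k₂ := n) (k₁ := n + 1) (k₀ := n + 2) rfl
      rfl, hd, hd]
    ext1
    refine LinearMap.ext fun α => ?_
    exact sub_eq_iff_eq_add.1 (singularHomotopy_coboundary α).symm

variable (K X n) in
lemma altMakerCohomology_comp_inclusionCohomology [CharZero K] :
    altMakerCohomology K n X ∘ₗ inclusionCohomology K n X = LinearMap.id := by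
  rw [altMakerCohomology, inclusionCohomology, ← ModuleCat.hom_comp,
    ← HomologicalComplex.homologyMap_comp, inclusion_comp_altMakerHom,
    HomologicalComplex.homologyMap_id, ModuleCat.hom_id]

variable (K X n) in
lemma inclusionCohomology_comp_altMakerCohomology [CharZero K] :
    inclusionCohomology K n X ∘ₗ altMakerCohomology K n X = LinearMap.id := by
  rw [altMakerCohomology, inclusionCohomology, ← ModuleCat.hom_comp,
    ← HomologicalComplex.homologyMap_comp, ← ModuleCat.hom_id,
    ← HomologicalComplex.homologyMap_id]
  congr 1
  have h := (Homotopy.nullHomotopy' (homotopyComponent K X)).homologyMap_eq n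
  rw [← altMakerHom_comp_inclusion, HomologicalComplex.homologyMap_sub,
    HomologicalComplex.homologyMap_zero, sub_eq_zero] at h
  exact h.symm

end Singular

end AltSingular

end

theorem corollary2 (K : Type) [Field K] [CharZero K] (X : Type*) [TopologicalSpace X]
    (n : ℕ) :
    AltSingular.altMakerCohomology K n X ∘ₗ AltSingular.inclusionCohomology K n X =
        LinearMap.id ∧
      IsCompl (LinearMap.range (AltSingular.inclusionCohomology K n X))
        (LinearMap.ker (AltSingular.altMakerCohomology K n X)) ∧
      (Module.Finite K (AltSingular.singularCohomology K n X) →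
        Function.Bijective (AltSingular.altMakerCohomology K n X)) ∧
      (CompactSpace X → Function.Bijective (AltSingular.altMakerCohomology K n X)) := by
  have hAj := AltSingular.altMakerCohomology_comp_inclusionCohomology K X n
  have hjA := AltSingular.inclusionCohomology_comp_altMakerCohomology K X n
  have hb : Function.Bijective (AltSingular.altMakerCohomology K n X) :=
    Function.bijective_iff_has_inverse.2 ⟨AltSingular.inclusionCohomology K n X,
      LinearMap.congr_fun hjA, LinearMap.congr_fun hAj⟩
  refine ⟨hAj, ?_, fun _ => hb, fun _ => hb⟩
  rw [LinearMap.ker_eq_bot.2 hb.1, LinearMap.range_eq_top.2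
    (Function.RightInverse.surjective (g := AltSingular.altMakerCohomology K n X)
      (LinearMap.congr_fun hjA))]
  exact isCompl_top_bot
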